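/- Let $k \ge 1$, write $[k] = \{1,\dots,k\}$, and let $G_k = \langle 1,\dots,k \mid 1^2,\dots,k^2\rangle$ be the group generated by $k$ involutions (the free product of $k$ cyclic groups of order two), with identity $e$. Each $x \in G_k$ has a unique reduced form $x = c_1 c_2 \cdots c_\ell$ with $c_i \in [k]$ and $c_{i-1} \ne c_i$; put $|x| = \ell$, and for $x \ne e$ put $\mathrm{pred}(x) = x c_\ell = c_1 \cdots c_{\ell-1}$. A $k$-colour system is a non-empty set $V \subseteq G_k$ such that $\mathrm{pred}(v) \in V$ for every $v \in V \setminus \{e\}$; it is viewed as an edge-coloured tree in which $v$ and $vc$ are joined by an edge of colour $c$ whenever $v, vc \in V$. Let $C(V,v) = \{c \in [k] : vc \in V\}$; the system $V$ is $d$-regular if $|C(V,v)| = d$ for all $v \in V$. For $S \subseteq G_k$, $x \in G_k$ and an integer $h \ge 0$ let $S[h] = \{s \in S : |s| \le h\}$ and $xS = \{xs : s \in S\}$. Let $A$ be a function that assigns an output $A(V,v) \in [k] \cup \{\bot\}$ to every $k$-colour system $V$ and every $v \in V$. We say that $A$ is a distributed algorithm with running time $r \in \{0,1,2,\dots\}$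 if, for all $k$-colour systems $U, V$ and all $u \in U$, $v \in V$, the equality $(u^{-1}U)[r+1] = (v^{-1}V)[r+1]$ implies $A(U,u) = A(V,v)$; and that $A$ is a distributed algorithm if it has some running time $r$. A distributed algorithm $A$ finds a maximal matching in $V$ if (M1) $A(V,v) \in C(V,v) \cup \{\bot\}$ for each $v \in V$; (M2) if $A(V,v) = c \ne \bot$, then $vc \in V$ and $A(V,vc) = c$; (M3) if $A(V,v) = \bot$ and $c \in C(V,v)$, then $A(V,vc) \ne \bot$. **Theorem.** Let $k \ge 3$ be an integer and let $d = k-1$. Assume that $A$ is a distributed algorithm that finds a maximal matching in every $d$-regular $k$-colour system. Then there are two $d$-regular $k$-colour systems $U$ and $V$ such that $U[d] = V[d]$, $A(U,e) \ne \bot$, and $A(V,e) = \bot$. In particular, every running time $r$ of $A$ satisfies $r \ge d = k-1$. -/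

import Mathlib

namespace MaximalMatching

/-- The group `G_k` generated by `k` involutions `c² = e` (and no other relations): the free product
of `k` cyclic groups of order two. The colours `[k]` are the elements of `Fin k`. -/
abbrev G (k : ℕ) : Type := Monoid.CoprodI (fun _ : Fin k => Multiplicative (ZMod 2))

/-- The generator of `G_k` that belongs to the colour `c`. -/
def gen {k : ℕ} (c : Fin k) : G k :=
  Monoid.CoprodI.of (M := fun _ : Fin k => Multiplicative (ZMod 2)) (i := c)
    (Multiplicative.ofAdd (1 : ZMod 2))

/-- The unique reduced form of `x`: the sequence of colours `c₁, …, c_ℓ` with `c_{i-1} ≠ c_i` and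
`x = c₁ ⋯ c_ℓ`. -/
def reducedForm {k : ℕ} (x : G k) : List (Fin k) :=
  (Monoid.CoprodI.Word.equiv x).toList.map Sigma.fst

/-- The norm `|x|`: the length of the reduced form. -/
def len {k : ℕ} (x : G k) : ℕ := (reducedForm x).length

/-- `c = tail(x)`: the colour `c` with `|xc| = |x| - 1`. For `x ≠ e` it exists and is unique, see
`existsUnique_isTail`. Then `pred(x) = x c`. -/
def IsTail {k : ℕ} (x : G k) (c : Fin k) : Prop := len (x * gen c) + 1 = len x

theorem zmod_two_eq (a : Multiplicative (ZMod 2)) (ha : a ≠ 1) :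
    a = Multiplicative.ofAdd (1 : ZMod 2) := by
  revert a
  decide

theorem reducedForm_isChain {k : ℕ} (x : G k) : (reducedForm x).IsChain (· ≠ ·) := by
  unfold reducedForm
  rw [List.isChain_map]
  exact (Monoid.CoprodI.Word.equiv x).chain_ne

theorem prod_reducedForm {k : ℕ} (x : G k) : ((reducedForm x).map gen).prod = x := by
  have h : (Monoid.CoprodI.Word.equiv x).prod = x := Monoid.CoprodI.Word.equiv.symm_apply_apply x
  conv_rhs => rw [← h]
  unfold Monoid.CoprodI.Word.prod reducedForm
  rw [List.map_map]
  congr 1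
  apply List.map_congr_left
  rintro ⟨i, a⟩ hl
  have := zmod_two_eq a ((Monoid.CoprodI.Word.equiv x).ne_one _ hl)
  subst this
  rfl

theorem reducedForm_prod {k : ℕ} (l : List (Fin k)) (hl : l.IsChain (· ≠ ·)) :
    reducedForm ((l.map gen).prod) = l := by
  let w : Monoid.CoprodI.Word (fun _ : Fin k => Multiplicative (ZMod 2)) :=
    { toList := l.map fun c => ⟨c, Multiplicative.ofAdd (1 : ZMod 2)⟩
      ne_one := by
        intro a ha
        obtain ⟨c, -, rfl⟩ := List.mem_map.1 ha
        exact (by decide : Multiplicative.ofAdd (1 : ZMod 2) ≠ 1)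
      chain_ne := by
        rw [List.isChain_map]
        exact hl }
  have hw : w.prod = (l.map gen).prod := by
    simp only [Monoid.CoprodI.Word.prod, w, List.map_map]
    rfl
  have : Monoid.CoprodI.Word.equiv ((l.map gen).prod) = w := by
    rw [← hw]
    exact Monoid.CoprodI.Word.equiv.apply_symm_apply w
  rw [reducedForm, this]
  simp [w, Function.comp_def]

theorem gen_mul_gen {k : ℕ} (c : Fin k) : gen c * gen c = 1 := by
  unfold gen
  rw [← map_mul]
  exact map_one _

theorem existsUnique_isTail {k : ℕ} (x : G k) (hx : x ≠ 1) : ∃! c : Fin k, IsTail x c := by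
  have h1 := prod_reducedForm x
  have h2 := reducedForm_isChain x
  rcases List.eq_nil_or_concat (reducedForm x) with h | ⟨l, c, h⟩
  · rw [h] at h1
    exact absurd h1.symm (by simpa using hx)
  rw [List.concat_eq_append] at h
  rw [h] at h1 h2
  have hlen : len x = l.length + 1 := by simp [len, h]
  refine ⟨c, ?_, ?_⟩
  · have : x * gen c = (l.map gen).prod := by
      rw [← h1]
      simp [mul_assoc, gen_mul_gen]
    change len (x * gen c) + 1 = len x
    rw [hlen, this, len, reducedForm_prod l (List.isChain_append.1 h2).1]
  · intro c' hc'
    by_contra hne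
    have : x * gen c' = ((l ++ [c] ++ [c']).map gen).prod := by
      rw [← h1]
      simp [mul_assoc]
    unfold IsTail at hc'
    rw [hlen, this, len, reducedForm_prod] at hc'
    · simp at hc'
    · rw [List.isChain_append]
      refine ⟨h2, by simp, ?_⟩
      simpa using fun h => hne h.symm

/-- A `k`-colour system: a non-empty subset `V` of `G_k` such that `pred(v) ∈ V` for every
`v ∈ V` with `v ≠ e`. -/
structure ColourSystem (k : ℕ) where
  carrier : Set (G k)
  nonempty : carrier.Nonempty
  pred_mem : ∀ v ∈ carrier, v ≠ 1 → ∀ c : Fin k, IsTail v c → v * gen c ∈ carrier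

theorem ColourSystem.one_mem {k : ℕ} (V : ColourSystem k) : (1 : G k) ∈ V.carrier := by
  have key : ∀ n : ℕ, ∀ v ∈ V.carrier, len v = n → (1 : G k) ∈ V.carrier := by
    intro n
    induction n with
    | zero =>
      intro v hv h
      have h0 : reducedForm v = [] := List.length_eq_zero_iff.1 h
      have h1 := prod_reducedForm v
      rw [h0] at h1
      simpa [← h1] using hv
    | succ n ih =>
      intro v hv h
      by_cases h1 : v = 1
      · exact h1 ▸ hv
      obtain ⟨c, hc, -⟩ := existsUnique_isTail v h1
      refine ih _ (V.pred_mem v hv h1 c hc) ?_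
      unfold IsTail at hc
      omega
  obtain ⟨v, hv⟩ := V.nonempty
  exact key _ v hv rfl

/-- The root `e` as a node of the colour system `V`. -/
def ColourSystem.root {k : ℕ} (V : ColourSystem k) : V.carrier := ⟨1, V.one_mem⟩

/-- `C(V, v)`: the set of colours of the edges of `V` that are incident to `v`. -/
def ColourSystem.colours {k : ℕ} (V : ColourSystem k) (v : G k) : Set (Fin k) :=
  {c | v * gen c ∈ V.carrier}

/-- `V` is `d`-regular: `|C(V, v)| = d` for every node `v`. -/
def ColourSystem.IsRegular {k : ℕ} (V : ColourSystem k) (d : ℕ) : Prop :=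
  ∀ v ∈ V.carrier, (V.colours v).ncard = d

/-- `S[h]`: the elements of `S` of norm at most `h`. -/
def trunc {k : ℕ} (S : Set (G k)) (h : ℕ) : Set (G k) := {v ∈ S | len v ≤ h}

/-- `xS = {x v : v ∈ S}`. -/
def translate {k : ℕ} (x : G k) (S : Set (G k)) : Set (G k) := (fun v => x * v) '' S

/-- A function that associates a local output `A(V, v)` with any `k`-colour system `V` and any node
`v ∈ V`: either `⊥` (unmatched) or a colour. -/
abbrev OutputMap (k : ℕ) : Type := (V : ColourSystem k) → V.carrier → WithBot (Fin k)

/-- `A` is a distributed algorithm with running time `r`: the output at a node `v` of `V` depends only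
on `(v⁻¹V)[r + 1]`, which is what the node knows after `r` rounds. -/
def OutputMap.HasRunningTime {k : ℕ} (A : OutputMap k) (r : ℕ) : Prop :=
  ∀ (U V : ColourSystem k) (u : U.carrier) (v : V.carrier),
    trunc (translate (u : G k)⁻¹ U.carrier) (r + 1) =
      trunc (translate (v : G k)⁻¹ V.carrier) (r + 1) → A U u = A V v

/-- `A` is a distributed algorithm: it has some (finite) running time. -/
def OutputMap.IsDistributedAlgorithm {k : ℕ} (A : OutputMap k) : Prop :=
  ∃ r : ℕ, A.HasRunningTime r

/-- `A` finds a maximal matching in `V`. -/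
structure OutputMap.FindsMaximalMatching {k : ℕ} (A : OutputMap k) (V : ColourSystem k) :
    Prop where
  /-- a node is unmatched or matched along an incident edge -/
  valid : ∀ v : V.carrier, A V v = ⊥ ∨ ∃ c ∈ V.colours v, A V v = (c : WithBot (Fin k))
  /-- the two ends of an edge agree -/
  consistent : ∀ (v : V.carrier) (c : Fin k), A V v = (c : WithBot (Fin k)) →
    ∃ h : (v : G k) * gen c ∈ V.carrier,
      A V ⟨(v : G k) * gen c, h⟩ = (c : WithBot (Fin k))
  /-- no two adjacent nodes are unmatched -/
  maximal : ∀ v : V.carrier, A V v = ⊥ → ∀ (c : Fin k) (h : (v : G k) * gen c ∈ V.carrier),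
    A V ⟨(v : G k) * gen c, h⟩ ≠ ⊥

end MaximalMatching

open MaximalMatching

/-! A template of degree `h` is an `h`-regular part `E` of the Cayley tree with one forbidden colour
at each node; the other colours are free and act as loops. Unfolding the loops gives a `(k -
1)`-regular system, in which all copies of a template node have the same view and hence the same
output. A free colour therefore excludes `⊥`, as two neighbours would both be unmatched
(`out_ne_bot`).

The induction on `h` runs over critical pairs: two templates that agree at distance less than `h`
from the root, where only the first is matched along an edge of `E`. While a free colour exists, the
second outputs some free `c`. Unfold `c` into edges in both templates and glue half of one to half
of the other across a `c`-edge. On that edge the glued template disagrees with one of the two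
originals. The disagreement spreads along an alternating path, which must stop because the algorithm
is local; where it stops, exactly one of the two templates is matched (`exists_matched_xor`), and
they agree at distance less than `h + 1` (`agree_mix`). At `h = k - 1` no colour is free, so a node
not matched along `E` outputs `⊥`. -/

namespace MaximalMatching

/-! ### Lengths and edge crossings in the Cayley tree -/

section Length

variable {k : ℕ}

theorem gen_inv (c : Fin k) : (gen c)⁻¹ = gen c :=
  inv_eq_of_mul_eq_one_left (gen_mul_gen c)

theorem mul_gen_mul_gen (x : G k) (c : Fin k) : x * gen c * gen c = x := by
  rw [mul_assoc, gen_mul_gen, mul_one]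

theorem gen_mul_gen_mul (c : Fin k) (x : G k) : gen c * (gen c * x) = x := by
  rw [← mul_assoc, gen_mul_gen, one_mul]

theorem len_prod_of_isChain (l : List (Fin k)) (hl : l.IsChain (· ≠ ·)) :
    len (l.map gen).prod = l.length := by
  rw [len, reducedForm_prod l hl]

theorem len_one : len (1 : G k) = 0 := len_prod_of_isChain [] List.isChain_nil

theorem len_gen (c : Fin k) : len (gen c) = 1 := by
  simpa using len_prod_of_isChain [c] (List.isChain_singleton c)

theorem len_mul_gen (x : G k) (c : Fin k) :
    len (x * gen c) = len x + 1 ∨ len (x * gen c) + 1 = len x := by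
  have h1 := prod_reducedForm x
  have h2 := reducedForm_isChain x
  by_cases h : (reducedForm x ++ [c]).IsChain (· ≠ ·)
  · left
    have := len_prod_of_isChain _ h
    simpa [h1, ← len.eq_def] using this
  · right
    by_cases hx : x = 1
    · subst hx
      have : reducedForm (1 : G k) = [] := List.length_eq_zero_iff.1 len_one
      rw [this] at h
      exact absurd (List.isChain_singleton c) h
    obtain ⟨b, hb, -⟩ := existsUnique_isTail x hx
    rcases List.eq_nil_or_concat (reducedForm x) with h' | ⟨l, a, h'⟩
    · rw [h'] at h
      exact absurd (List.isChain_singleton c) h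
    rw [List.concat_eq_append] at h'
    have hac : a = c := by
      by_contra hne
      apply h
      rw [List.isChain_append]
      refine ⟨h2, List.isChain_singleton c, ?_⟩
      rw [h']
      simpa using hne
    subst hac
    have hl : l.IsChain (· ≠ ·) := by
      rw [h'] at h2
      exact (List.isChain_append.1 h2).1
    have e1 : x * gen a = (l.map gen).prod := by
      rw [← h1, h']
      simp [mul_assoc, gen_mul_gen]
    rw [e1, len_prod_of_isChain l hl, len, h']
    simp

theorem len_inv (x : G k) : len x⁻¹ = len x := by
  have h1 := prod_reducedForm x
  have h2 := reducedForm_isChain x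
  have h3 : x⁻¹ = ((reducedForm x).reverse.map gen).prod := by
    conv_lhs => rw [← h1]
    rw [List.prod_inv_reverse, List.map_map, List.map_reverse]
    congr 2
  rw [h3, len_prod_of_isChain, List.length_reverse, ← len.eq_def]
  rw [List.isChain_reverse]
  exact h2.imp fun _ _ h => h.symm

theorem len_gen_mul (c : Fin k) (x : G k) :
    len (gen c * x) = len x + 1 ∨ len (gen c * x) + 1 = len x := by
  have h : len (gen c * x) = len (x⁻¹ * gen c) := by
    rw [← len_inv, mul_inv_rev, gen_inv]
  rw [h, ← len_inv x]
  exact len_mul_gen _ _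

theorem len_prod_le (l : List (Fin k)) : len (l.map gen).prod ≤ l.length := by
  induction l with
  | nil => simp [len_one]
  | cons c l ih =>
    have := len_gen_mul c (l.map gen).prod
    simp only [List.map_cons, List.prod_cons, List.length_cons]
    omega

theorem isTail_unique {x : G k} {a b : Fin k} (ha : IsTail x a) (hb : IsTail x b) : a = b := by
  by_cases hx : x = 1
  · subst hx
    simp [IsTail, len_one] at ha
  · exact (existsUnique_isTail x hx).unique ha hb

theorem isTail_mul_gen {x : G k} {c : Fin k} (h : len (x * gen c) = len x + 1) :
    IsTail (x * gen c) c := by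
  rw [IsTail, mul_gen_mul_gen, h]

/-- The only edge of the Cayley tree that leaves the side of `1` of the edge `{1, c}` is that
edge itself. -/
theorem eq_of_crossing {c b : Fin k} {x : G k} (hx : len (gen c * x) = len x + 1)
    (hb : len (gen c * (x * gen b)) ≠ len (x * gen b) + 1) : x = 1 ∧ b = c := by
  have h1 := len_gen_mul c (x * gen b)
  have h2 := len_mul_gen x b
  have h3 := len_mul_gen (gen c * x) b
  rw [mul_assoc] at h3
  have ht : IsTail (gen c * x) b := by
    rw [IsTail, mul_assoc]
    omega
  have hx1 : x = 1 := by
    by_contra hne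
    obtain ⟨a, ha, -⟩ := existsUnique_isTail x hne
    have h4 := len_mul_gen (gen c * x) a
    have h5 := len_gen_mul c (x * gen a)
    have ha' : IsTail (gen c * x) a := by
      unfold IsTail at ha ⊢
      rw [mul_assoc] at h4 ⊢
      omega
    have hab := isTail_unique ha' ht
    subst hab
    unfold IsTail at ha
    omega
  subst hx1
  refine ⟨rfl, isTail_unique ht ?_⟩
  rw [mul_one, IsTail, gen_mul_gen, len_one, len_gen]

/-- By `eq_of_crossing` the walk changes sides only along the edge `{1, c}`. That step uses up one
letter, and the letters after it bound the distance from `gen c` to the end. The strict inequality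
is what gains a unit of radius in `agree_mix`. -/
theorem len_lt_of_crossing {c : Fin k} (l : List (Fin k)) {x : G k}
    (hx : len (gen c * x) = len x + 1)
    (hl : len (gen c * (x * (l.map gen).prod)) ≠ len (x * (l.map gen).prod) + 1) :
    len (gen c * (x * (l.map gen).prod)) < l.length := by
  induction l generalizing x with
  | nil => exact absurd (by simpa using hx) hl
  | cons b l ih =>
    simp only [List.map_cons, List.prod_cons, List.length_cons] at hl ⊢
    rw [← mul_assoc x] at hl ⊢
    by_cases hb : len (gen c * (x * gen b)) = len (x * gen b) + 1
    · exact (ih hb hl).trans (Nat.lt_succ_self _)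
    · obtain ⟨rfl, rfl⟩ := eq_of_crossing hx hb
      rw [one_mul, gen_mul_gen_mul]
      exact Nat.lt_succ_of_le (len_prod_le l)

theorem len_gen_mul_mul_lt {c : Fin k} {x z : G k} (hx : len (gen c * x) = len x + 1)
    (hz : len (gen c * (x * z)) ≠ len (x * z) + 1) : len (gen c * (x * z)) < len z := by
  have := len_lt_of_crossing (reducedForm z) hx
  rw [prod_reducedForm] at this
  exact this hz

end Length

/-! ### Regular systems as components after deleting a perfect matching -/

section Component

variable {k : ℕ}

/-- The nodes reached from `1` along a non-backtracking path that never leaves a node `x` along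
the colour `m x`. -/
inductive Reach (m : G k → Fin k) : G k → Prop
  | one : Reach m 1
  | step (x : G k) (c : Fin k) (hx : Reach m x) (hc : c ≠ m x)
      (hl : len (x * gen c) = len x + 1) : Reach m (x * gen c)

theorem Reach.of_isTail {m : G k → Fin k} {x : G k} {c : Fin k} (hx : Reach m x)
    (hc : IsTail x c) : Reach m (x * gen c) ∧ c ≠ m (x * gen c) := by
  cases hx with
  | one => simp [IsTail, len_one] at hc
  | step y b hy hb hl =>
    have hbc := isTail_unique hc (isTail_mul_gen hl)
    subst hbc
    rw [mul_gen_mul_gen]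
    exact ⟨hy, hb⟩

theorem Reach.mul_gen {m : G k → Fin k} {x : G k} {c : Fin k} (hx : Reach m x)
    (hc : c ≠ m x) : Reach m (x * gen c) := by
  rcases len_mul_gen x c with h | h
  · exact hx.step x c hc h
  · exact (hx.of_isTail h).1

/-- By `hm` both ends of an edge agree on its deletion, so the rule for outward steps also governs
the step back towards `1`. -/
theorem Reach.mul_gen_iff {m : G k → Fin k} (hm : ∀ x, m (x * gen (m x)) = m x) {x : G k}
    {c : Fin k} (hx : Reach m x) : Reach m (x * gen c) ↔ c ≠ m x := by
  refine ⟨fun h hc => ?_, hx.mul_gen⟩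
  rcases len_mul_gen x c with hl | hl
  · have := (h.of_isTail (isTail_mul_gen hl)).2
    rw [mul_gen_mul_gen] at this
    exact this hc
  · apply (hx.of_isTail hl).2
    rw [hc, hm]

/-- Reaching `x` consults `m` only at proper prefixes of `x`; hence `<` in the hypothesis against
`≤` in the conclusion. -/
theorem Reach.congr {m m' : G k → Fin k} {n : ℕ} (h : ∀ x, len x < n → m x = m' x) {x : G k}
    (hx : Reach m x) (hn : len x ≤ n) : Reach m' x := by
  induction hx with
  | one => exact .one
  | step x c hx hc hl ih =>
    exact .step x c (ih (by omega)) (h x (by omega) ▸ hc) hl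

theorem Reach.translate {m : G k → Fin k} {c : Fin k} (hc : c ≠ m (gen c)) {x : G k}
    (hx : Reach m x) : Reach (fun y => m (gen c * y)) (gen c * x) := by
  induction hx with
  | one =>
    have := (Reach.one (m := fun y => m (gen c * y))).mul_gen (c := c) (by simpa using hc)
    simpa using this
  | step x b hx hb hl ih =>
    rw [← mul_assoc]
    exact ih.mul_gen (by simpa [gen_mul_gen_mul] using hb)

/-- The connected component of `1` after the removal of all edges `{x, x (m x)}`. -/
def component (m : G k → Fin k) : ColourSystem k where
  carrier := {x | Reach m x}
  nonempty := ⟨1, .one⟩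
  pred_mem := fun _ hv _ _ hc => (Reach.of_isTail hv hc).1

theorem component_isRegular {m : G k → Fin k} (hm : ∀ x, m (x * gen (m x)) = m x) :
    (component m).IsRegular (k - 1) := by
  intro v hv
  have : (component m).colours v = {m v}ᶜ := by
    ext c
    exact Reach.mul_gen_iff hm hv
  rw [this, Set.ncard_compl, Set.ncard_singleton, Nat.card_eq_fintype_card, Fintype.card_fin]

theorem trunc_component {m m' : G k → Fin k} {n : ℕ} (h : ∀ x, len x < n → m x = m' x) :
    trunc (component m).carrier n = trunc (component m').carrier n := by
  ext x
  exact ⟨fun hx => ⟨Reach.congr h hx.1 hx.2, hx.2⟩,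
    fun hx => ⟨Reach.congr (fun y hy => (h y hy).symm) hx.1 hx.2, hx.2⟩⟩

theorem translate_component {m : G k → Fin k} (hm : ∀ x, m (x * gen (m x)) = m x) {c : Fin k}
    (hc : c ≠ m 1) :
    MaximalMatching.translate (gen c)⁻¹ (component m).carrier =
      (component fun y => m (gen c * y)).carrier := by
  have hc' : c ≠ m (gen c) := by
    intro h
    have := hm (gen c)
    rw [← h, gen_mul_gen] at this
    exact hc this.symm
  rw [gen_inv]
  ext x
  constructor
  · rintro ⟨y, hy, rfl⟩
    exact Reach.translate hc' hy
  · intro hx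
    refine ⟨gen c * x, ?_, gen_mul_gen_mul c x⟩
    have := Reach.translate (m := fun y => m (gen c * y)) (c := c)
      (by simpa [gen_mul_gen] using hc) hx
    simpa [gen_mul_gen_mul, component] using this

theorem translate_one (S : Set (G k)) : MaximalMatching.translate (1 : G k)⁻¹ S = S := by
  simp [MaximalMatching.translate]

end Component

/-! ### Templates and their unfoldings -/

/-- An `h`-regular spanning subgraph `E` of the Cayley tree of `G k`, together with a forbidden
colour `m x` at every node `x`. -/
structure Template (k h : ℕ) where
  E : G k → Finset (Fin k)
  m : G k → Fin k
  card_E : ∀ x, (E x).card = h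
  m_notMem : ∀ x, m x ∉ E x
  symm : ∀ x c, c ∈ E x → c ∈ E (x * gen c)

/-- The homomorphism from the cyclic group of order two given by an involution. -/
def homOfInvolution {M : Type*} [Monoid M] (s : M) (hs : s * s = 1) :
    Multiplicative (ZMod 2) →* M where
  toFun a := if a = 1 then 1 else s
  map_one' := if_pos rfl
  map_mul' a b := by
    by_cases ha : a = 1
    · simp [ha]
    by_cases hb : b = 1
    · simp [hb]
    rw [if_neg ha, if_neg hb, hs, zmod_two_eq a ha, zmod_two_eq b hb, if_pos]
    decide

namespace Template

variable {k h : ℕ} (T : Template k h)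

/-- One step along the colour `c`, or none if the template has no such edge. -/
def move (c : Fin k) (x : G k) : G k := if c ∈ T.E x then x * gen c else x

theorem move_move (c : Fin k) (x : G k) : T.move c (T.move c x) = x := by
  unfold move
  by_cases h : c ∈ T.E x
  · rw [if_pos h, if_pos (T.symm x c h), mul_gen_mul_gen]
  · rw [if_neg h, if_neg h]

/-- Products in `Function.End` are compositions, so this is a left action; `act` inverts the
argument to get a right action. -/
def moveHom : G k →* Function.End (G k) :=
  Monoid.CoprodI.lift fun c => homOfInvolution (M := Function.End (G k)) (T.move c)
    (funext (T.move_move c))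

theorem moveHom_gen (c : Fin k) : T.moveHom (gen c) = T.move c := by
  rw [moveHom, gen, Monoid.CoprodI.lift_of]
  rfl

/-- The end of the walk from `x` along the colours of `y` that ignores the colours without an
edge in the template. -/
def act (x y : G k) : G k := T.moveHom y⁻¹ x

theorem act_one (x : G k) : T.act x 1 = x := by
  rw [act, inv_one, map_one]
  rfl

theorem act_mul (x y z : G k) : T.act x (y * z) = T.act (T.act x y) z := by
  rw [act, mul_inv_rev, map_mul]
  rfl

theorem act_gen (x : G k) (c : Fin k) : T.act x (gen c) = T.move c x := by
  rw [act, gen_inv, moveHom_gen]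

theorem act_gen_of_mem {x : G k} {c : Fin k} (h : c ∈ T.E x) :
    T.act x (gen c) = x * gen c := by
  rw [act_gen, move, if_pos h]

theorem act_gen_of_notMem {x : G k} {c : Fin k} (h : c ∉ T.E x) : T.act x (gen c) = x := by
  rw [act_gen, move, if_neg h]

/-- Two templates, possibly of different degrees, look the same from `x` and from `x'` up to
distance `n`. -/
def Agree {h' : ℕ} (T' : Template k h') (x x' : G k) (n : ℕ) : Prop :=
  ∀ z, len z < n → T.E (x * z) = T'.E (x' * z) ∧ T.m (x * z) = T'.m (x' * z)

variable {T} in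
-- Each letter is decided by the edges at the current node, which is still at distance less than
-- `n`, so both walks make the same moves.
theorem Agree.act_prod {h' : ℕ} {T' : Template k h'} {x x' : G k} {n : ℕ}
    (H : T.Agree T' x x' n) (l : List (Fin k)) (hl : l.length ≤ n) :
    ∃ z, len z ≤ l.length ∧ T.act x (l.map gen).prod = x * z ∧
      T'.act x' (l.map gen).prod = x' * z := by
  induction l using List.reverseRecOn with
  | nil => exact ⟨1, by simp [len_one], by simp [act_one], by simp [act_one]⟩
  | append_singleton l c ih =>
    simp only [List.length_append, List.length_singleton] at hl
    obtain ⟨z, hz, h1, h2⟩ := ih (by omega)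
    simp only [List.map_append, List.prod_append, List.length_append, List.length_singleton,
      List.map_cons, List.map_nil, List.prod_singleton, act_mul, h1, h2]
    have hE := (H z (by omega)).1
    have := len_mul_gen z c
    by_cases hc : c ∈ T.E (x * z)
    · refine ⟨z * gen c, by omega, ?_, ?_⟩
      · rw [act_gen_of_mem _ hc, mul_assoc]
      · rw [act_gen_of_mem _ (hE ▸ hc), mul_assoc]
    · exact ⟨z, by omega, act_gen_of_notMem _ hc, act_gen_of_notMem _ (hE ▸ hc)⟩

variable {T} in
theorem Agree.act {h' : ℕ} {T' : Template k h'} {x x' : G k} {n : ℕ}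
    (H : T.Agree T' x x' n) (y : G k) (hy : len y ≤ n) :
    ∃ z, len z ≤ len y ∧ T.act x y = x * z ∧ T'.act x' y = x' * z := by
  have := H.act_prod (reducedForm y) hy
  rwa [prod_reducedForm] at this

/-- The colour system obtained from the template by attaching loops of all free colours and
unfolding from `x`. -/
def real (x : G k) : ColourSystem k := component fun y => T.m (T.act x y)

theorem m_act_mul_gen (x y : G k) :
    T.m (T.act x (y * gen (T.m (T.act x y)))) = T.m (T.act x y) := by
  rw [act_mul, act_gen_of_notMem _ (T.m_notMem _)]

theorem real_isRegular (x : G k) : (T.real x).IsRegular (k - 1) :=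
  component_isRegular (T.m_act_mul_gen x)

variable {T} in
theorem Agree.trunc_real {h' : ℕ} {T' : Template k h'} {x x' : G k} {n : ℕ}
    (H : T.Agree T' x x' n) :
    trunc (T.real x).carrier n = trunc (T'.real x').carrier n := by
  refine trunc_component fun y hy => ?_
  obtain ⟨z, hz, h1, h2⟩ := H.act y hy.le
  rw [h1, h2, (H z (by omega)).2]

/-! ### Outputs on templates -/

/-- The output of the algorithm at the root of the unfolding from `x`. -/
def out (A : OutputMap k) (x : G k) : WithBot (Fin k) := A (T.real x) (T.real x).root

variable {A : OutputMap k} {r : ℕ}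

variable {T} in
theorem Agree.out_eq (hr : A.HasRunningTime r) {h' : ℕ} {T' : Template k h'} {x x' : G k}
    (H : T.Agree T' x x' (r + 1)) : T.out A x = T'.out A x' := by
  refine hr _ _ _ _ ?_
  simp only [ColourSystem.root, translate_one]
  exact H.trunc_real

theorem gen_mem_real_iff (x : G k) (c : Fin k) :
    (1 : G k) * gen c ∈ (T.real x).carrier ↔ c ≠ T.m x := by
  have := Reach.mul_gen_iff (m := fun y => T.m (T.act x y)) (T.m_act_mul_gen x) .one (c := c)
  rwa [act_one] at this

/-- Rerooting the unfolding at a neighbour gives the unfolding from the template node reached, which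
is `x` itself when `c` is a loop. -/
theorem out_act_gen (hr : A.HasRunningTime r) (x : G k) (c : Fin k)
    (hc : (1 : G k) * gen c ∈ (T.real x).carrier) :
    A (T.real x) ⟨1 * gen c, hc⟩ = T.out A (T.act x (gen c)) := by
  refine hr _ _ _ _ ?_
  simp only [ColourSystem.root, translate_one, one_mul]
  have hc' := (T.gen_mem_real_iff x c).1 hc
  rw [real, translate_component (T.m_act_mul_gen x) (by rwa [act_one]), real]
  simp only [act_mul]

variable (hr : A.HasRunningTime r)
  (hmatch : ∀ V : ColourSystem k, V.IsRegular (k - 1) → A.FindsMaximalMatching V)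

include hmatch in
theorem out_ne_m (x : G k) : T.out A x ≠ (T.m x : WithBot (Fin k)) := by
  intro hx
  obtain ⟨h1, -⟩ := (hmatch _ (T.real_isRegular x)).consistent _ _ hx
  exact (T.gen_mem_real_iff x _).1 h1 rfl

include hr hmatch in
theorem out_act {x : G k} {c : Fin k} (hx : T.out A x = (c : WithBot (Fin k))) :
    T.out A (T.act x (gen c)) = (c : WithBot (Fin k)) := by
  obtain ⟨h1, h2⟩ := (hmatch _ (T.real_isRegular x)).consistent _ _ hx
  rw [← h2]
  exact (T.out_act_gen hr x c h1).symm

theorem exists_free (hh : h + 1 < k) (x : G k) : ∃ c, c ∉ T.E x ∧ c ≠ T.m x := by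
  have h1 : (insert (T.m x) (T.E x)).card < (Finset.univ : Finset (Fin k)).card := by
    rw [Finset.card_insert_of_notMem (T.m_notMem x), T.card_E, Finset.card_univ,
      Fintype.card_fin]
    exact hh
  obtain ⟨c, -, hc⟩ := Finset.exists_mem_notMem_of_card_lt_card h1
  rw [Finset.mem_insert, not_or] at hc
  exact ⟨c, hc.2, hc.1⟩

include hr hmatch in
theorem out_ne_bot (hh : h + 1 < k) (x : G k) : T.out A x ≠ ⊥ := by
  intro hx
  obtain ⟨c, hc, hc'⟩ := T.exists_free hh x
  have h1 := (T.gen_mem_real_iff x c).2 hc'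
  apply (hmatch _ (T.real_isRegular x)).maximal _ hx c h1
  have := T.out_act_gen hr x c h1
  rw [act_gen_of_notMem _ hc, hx] at this
  exact this

/-- The template rooted at `y` instead of `1`. -/
def shift (y : G k) : Template k h where
  E x := T.E (y * x)
  m x := T.m (y * x)
  card_E x := T.card_E _
  m_notMem x := T.m_notMem _
  symm x c hc := by
    rw [← mul_assoc]
    exact T.symm _ _ hc

include hr in
theorem out_shift (y : G k) : (T.shift y).out A 1 = T.out A y :=
  Agree.out_eq hr fun z _ => by simp [shift]

/-! ### Raising the degree by unfolding loops -/

open Classical in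
/-- A free colour; it is `c` whenever possible. -/
noncomputable def pick (c : Fin k) (x : G k) : Fin k :=
  if h : ∃ b, b ∉ T.E x ∧ b ≠ T.m x then
    if c ∉ T.E x ∧ c ≠ T.m x then c else Classical.choose h
  else c

theorem pick_spec (hh : h + 1 < k) (c : Fin k) (x : G k) :
    T.pick c x ∉ T.E x ∧ T.pick c x ≠ T.m x := by
  have hx := T.exists_free hh x
  rw [pick, dif_pos hx]
  split_ifs with h
  · exact h
  · exact Classical.choose_spec hx

theorem pick_eq {c : Fin k} {x : G k} (h : c ∉ T.E x) (h' : c ≠ T.m x) : T.pick c x = c := by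
  rw [pick, dif_pos ⟨c, h, h'⟩, if_pos ⟨h, h'⟩]

/-- The template of degree `h + 1` obtained by turning the loops of the picked colours into
edges, that is, by unfolding them. -/
noncomputable def extend (hh : h + 1 < k) (c : Fin k) : Template k (h + 1) where
  E x := insert (T.pick c (T.act 1 x)) (T.E (T.act 1 x))
  m x := T.m (T.act 1 x)
  card_E x := by rw [Finset.card_insert_of_notMem (T.pick_spec hh c _).1, T.card_E]
  m_notMem x := by
    rw [Finset.mem_insert, not_or]
    exact ⟨(T.pick_spec hh c _).2.symm, T.m_notMem _⟩
  symm x b hb := by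
    rw [act_mul]
    by_cases h : b ∈ T.E (T.act 1 x)
    · rw [act_gen_of_mem _ h]
      exact Finset.mem_insert_of_mem (T.symm _ _ h)
    · rwa [act_gen_of_notMem _ h]

variable (hh : h + 1 < k) (c : Fin k)

/-- `T.act 1` projects the extension onto `T` and sends the new edges to loops, so it commutes with
walking. -/
theorem act_one_act_extend_gen (x : G k) (b : Fin k) :
    T.act 1 ((T.extend hh c).act x (gen b)) = T.act (T.act 1 x) (gen b) := by
  by_cases h : b ∈ (T.extend hh c).E x
  · rw [act_gen_of_mem _ h, act_mul]
  · rw [act_gen_of_notMem _ h, act_gen_of_notMem]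
    exact fun h' => h (Finset.mem_insert_of_mem h')

theorem act_one_act_extend (x y : G k) :
    T.act 1 ((T.extend hh c).act x y) = T.act (T.act 1 x) y := by
  rw [← prod_reducedForm y]
  induction reducedForm y using List.reverseRecOn with
  | nil => simp [act_one]
  | append_singleton l b ih =>
    simp only [List.map_append, List.prod_append, List.map_cons, List.map_nil,
      List.prod_singleton, act_mul]
    rw [act_one_act_extend_gen, ih]

theorem out_extend (x : G k) : (T.extend hh c).out A x = T.out A (T.act 1 x) := by
  have : (T.extend hh c).real x = T.real (T.act 1 x) := by
    unfold real
    congr 1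
    funext y
    exact congrArg T.m (T.act_one_act_extend hh c x y)
  unfold out
  rw [this]

variable {T} in
-- For fixed `c`, the picked colour depends only on the edge set and forbidden colour at the node,
-- so equal local data give equal picks.
theorem Agree.extend {T' : Template k h} {n : ℕ} (H : T.Agree T' 1 1 n) :
    (T.extend hh c).Agree (T'.extend hh c) 1 1 n := by
  intro z hz
  obtain ⟨w, hw, h1, h2⟩ := H.act z hz.le
  obtain ⟨h3, h4⟩ := H w (by omega)
  simp only [one_mul] at h1 h2 h3 h4 ⊢
  simp only [Template.extend, pick, h1, h2, h3, h4, and_self]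

theorem extend_gen_mul (hc : c ∉ T.E 1) (x : G k) :
    (T.extend hh c).E (gen c * x) = (T.extend hh c).E x ∧
      (T.extend hh c).m (gen c * x) = (T.extend hh c).m x := by
  simp only [extend, act_mul, act_gen_of_notMem _ hc, and_self]

/-! ### Gluing two templates across an edge -/

variable {c}

/-- The template that equals `K` on the side of `1` of the edge `{1, c}`, and `L`, seen from the
other end, across that edge. -/
def mix (K L : Template k h) (hK : c ∈ K.E 1) (hL : c ∈ L.E 1) : Template k h where
  E x := if len (gen c * x) = len x + 1 then K.E x else L.E (gen c * x)
  m x := if len (gen c * x) = len x + 1 then K.m x else L.m (gen c * x)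
  card_E x := by
    split_ifs
    · exact K.card_E _
    · exact L.card_E _
  m_notMem x := by
    split_ifs
    · exact K.m_notMem _
    · exact L.m_notMem _
  symm x b hb := by
    split_ifs at hb with hx
    · by_cases hxb : len (gen c * (x * gen b)) = len (x * gen b) + 1
      · rw [if_pos hxb]
        exact K.symm _ _ hb
      · rw [if_neg hxb]
        obtain ⟨rfl, rfl⟩ := eq_of_crossing hx hxb
        rwa [one_mul, gen_mul_gen]
    · by_cases hxb : len (gen c * (x * gen b)) = len (x * gen b) + 1
      · rw [if_pos hxb]
        have h1 := len_gen_mul c x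
        have h2 : gen c * x = 1 ∧ b = c := by
          apply eq_of_crossing
          · rw [gen_mul_gen_mul]
            omega
          · rw [mul_assoc, gen_mul_gen_mul]
            omega
        obtain ⟨h3, rfl⟩ := h2
        have h4 : x = gen b := by rw [← gen_mul_gen_mul b x, h3, mul_one]
        rwa [h4, gen_mul_gen]
      · rw [if_neg hxb, ← mul_assoc]
        exact L.symm _ _ hb

theorem mix_of_pos {K L : Template k h} (hK : c ∈ K.E 1) (hL : c ∈ L.E 1) {x : G k}
    (hx : len (gen c * x) = len x + 1) :
    (mix K L hK hL).E x = K.E x ∧ (mix K L hK hL).m x = K.m x := by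
  simp only [mix, if_pos hx, and_self]

theorem mix_of_neg {K L : Template k h} (hK : c ∈ K.E 1) (hL : c ∈ L.E 1) {x : G k}
    (hx : len (gen c * x) ≠ len x + 1) :
    (mix K L hK hL).E x = L.E (gen c * x) ∧ (mix K L hK hL).m x = L.m (gen c * x) := by
  simp only [mix, if_neg hx, and_self]

theorem mix_gen_mul {K L : Template k h} (hK : c ∈ K.E 1) (hL : c ∈ L.E 1) (x : G k) :
    (mix K L hK hL).E (gen c * x) = (mix L K hL hK).E x ∧
      (mix K L hK hL).m (gen c * x) = (mix L K hL hK).m x := by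
  have h1 := len_gen_mul c x
  by_cases hx : len (gen c * x) = len x + 1
  · have hx' : len (gen c * (gen c * x)) ≠ len (gen c * x) + 1 := by
      rw [gen_mul_gen_mul]
      omega
    have h2 := mix_of_neg hK hL hx'
    rw [gen_mul_gen_mul] at h2
    have h3 := mix_of_pos hL hK hx
    exact ⟨h2.1.trans h3.1.symm, h2.2.trans h3.2.symm⟩
  · have hx' : len (gen c * (gen c * x)) = len (gen c * x) + 1 := by
      rw [gen_mul_gen_mul]
      omega
    have h2 := mix_of_pos hK hL hx'
    have h3 := mix_of_neg hL hK hx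
    exact ⟨h2.1.trans h3.1.symm, h2.2.trans h3.2.symm⟩

/-- A node `y * z` across the edge is at distance less than `len z` from `gen c`. There the mix
shows `L`, which agrees with `K` to radius `n`, and `hKc` reflects `K` back. -/
theorem agree_mix {K L : Template k h} (hK : c ∈ K.E 1) (hL : c ∈ L.E 1) {n : ℕ}
    (hKL : K.Agree L 1 1 n)
    (hKc : ∀ x, K.E (gen c * x) = K.E x ∧ K.m (gen c * x) = K.m x) {y : G k}
    (hy : len (gen c * y) = len y + 1) : K.Agree (mix K L hK hL) y y (n + 1) := by
  intro z hz
  by_cases hyz : len (gen c * (y * z)) = len (y * z) + 1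
  · have := mix_of_pos hK hL hyz
    exact ⟨this.1.symm, this.2.symm⟩
  · have h1 := mix_of_neg hK hL hyz
    have h2 := len_gen_mul_mul_lt hy hyz
    have h3 := hKL (gen c * (y * z)) (by omega)
    have h4 := hKc (y * z)
    simp only [one_mul] at h3
    rw [h1.1, h1.2, ← h3.1, ← h3.2, h4.1, h4.2]
    exact ⟨rfl, rfl⟩

/-- Far inside the side of `1`, a mixed template cannot be distinguished from `K`. -/
theorem agree_mix_of_le {K L : Template k h} (hK : c ∈ K.E 1) (hL : c ∈ L.E 1) {y : G k}
    (hy : len (gen c * y) = len y + 1) : K.Agree (mix K L hK hL) y y (len y + 1) := by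
  intro z hz
  have hyz : len (gen c * (y * z)) = len (y * z) + 1 := by
    by_contra hyz
    -- The return walk `z⁻¹` from across the edge would force `len y < len z`.
    have h1 := len_gen_mul_mul_lt (z := z⁻¹) (x := gen c * (y * z)) (c := c)
      (by rw [gen_mul_gen_mul]; have := len_gen_mul c (y * z); omega)
      (by rw [mul_assoc, gen_mul_gen_mul, mul_inv_cancel_right]; omega)
    rw [mul_assoc, gen_mul_gen_mul, mul_inv_cancel_right, len_inv] at h1
    omega
  have := mix_of_pos hK hL hyz
  exact ⟨this.1.symm, this.2.symm⟩

/-! ### Alternating paths and critical pairs -/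

/-- The output at `x` of the template is an edge of the template. -/
def Matched (A : OutputMap k) (x : G k) : Prop := ∃ b ∈ T.E x, T.out A x = (b : WithBot (Fin k))

include hr hmatch in
/-- One step of an alternating path. -/
theorem out_ne_of_edge {K X : Template k h} {y : G k} {b : Fin k} (hbK : b ∈ K.E y)
    (hbX : b ∈ X.E y) (hK : K.out A y = (b : WithBot (Fin k))) (hX : X.out A y ≠ K.out A y) :
    K.out A (y * gen b) = (b : WithBot (Fin k)) ∧
      X.out A (y * gen b) ≠ (b : WithBot (Fin k)) := by
  constructor
  · rw [← act_gen_of_mem K hbK]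
    exact K.out_act hr hmatch hK
  · intro h
    have h1 := X.out_act hr hmatch h
    rw [act_gen_of_mem X (X.symm _ _ hbX), mul_gen_mul_gen] at h1
    exact hX (h1.trans hK.symm)

include hr hmatch in
-- Otherwise the alternating path that starts with the edge `{1, c}` could always be continued away
-- from it, to distances where the algorithm cannot tell the mix from `K`.
theorem exists_matched_xor {K L : Template k h} (hK : c ∈ K.E 1) (hL : c ∈ L.E 1)
    (hc : K.out A 1 = (c : WithBot (Fin k)) ∧ (mix K L hK hL).out A 1 ≠ (c : WithBot (Fin k)) ∨
      (mix K L hK hL).out A 1 = (c : WithBot (Fin k)) ∧ K.out A 1 ≠ (c : WithBot (Fin k))) :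
    ∃ y, len (gen c * y) = len y + 1 ∧ ¬(K.Matched A y ↔ (mix K L hK hL).Matched A y) := by
  by_contra! hcon
  set X := mix K L hK hL with hX
  -- The colour `a` leads back towards `gen c`; taking the tail of `gen c * y` makes it `c` when `y
  -- = 1`.
  have path : ∀ n : ℕ, ∃ y : G k, ∃ a : Fin k, len y = n ∧ len (gen c * y) = len y + 1 ∧
      IsTail (gen c * y) a ∧ a ∈ K.E y ∧
      (K.out A y = (a : WithBot (Fin k)) ∧ X.out A y ≠ (a : WithBot (Fin k)) ∨
        X.out A y = (a : WithBot (Fin k)) ∧ K.out A y ≠ (a : WithBot (Fin k))) := by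
    intro n
    induction n with
    | zero =>
      refine ⟨1, c, len_one, by simp [len_one, len_gen], ?_, hK, hc⟩
      simp [IsTail, gen_mul_gen, len_one, len_gen]
    | succ n ih =>
      obtain ⟨y, a, hn, hy, ha, haE, hor⟩ := ih
      have hE : X.E y = K.E y := (mix_of_pos hK hL hy).1
      have next : ∀ b, b ∈ K.E y → b ≠ a → len (y * gen b) = n + 1 ∧
          len (gen c * (y * gen b)) = len (y * gen b) + 1 ∧ IsTail (gen c * (y * gen b)) b ∧
          b ∈ K.E (y * gen b) := by
        intro b hb hba
        have h1 := len_mul_gen (gen c * y) b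
        have h2 : ¬ len (gen c * y * gen b) + 1 = len (gen c * y) :=
          fun h => hba (isTail_unique h ha)
        have h3 := len_mul_gen y b
        have h4 := len_gen_mul c (y * gen b)
        have h5 := isTail_mul_gen (h1.resolve_right h2)
        rw [mul_assoc] at h1 h2 h5
        exact ⟨by omega, by omega, h5, K.symm _ _ hb⟩
      rcases hor with ⟨h1, h2⟩ | ⟨h1, h2⟩
      · obtain ⟨b, hb, hb'⟩ := (hcon y hy).1 ⟨a, haE, h1⟩
        have hba : b ≠ a := by
          rintro rfl
          exact h2 hb'
        rw [hE] at hb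
        obtain ⟨e1, e2, e3, e4⟩ := next b hb hba
        refine ⟨_, b, e1, e2, e3, e4, .inr (out_ne_of_edge hr hmatch (hE ▸ hb) hb hb' ?_)⟩
        rw [h1]
        exact h2.symm
      · obtain ⟨b, hb, hb'⟩ := (hcon y hy).2 ⟨a, hE ▸ haE, h1⟩
        have hba : b ≠ a := by
          rintro rfl
          exact h2 hb'
        obtain ⟨e1, e2, e3, e4⟩ := next b hb hba
        refine ⟨_, b, e1, e2, e3, e4, .inl (out_ne_of_edge hr hmatch hb (hE ▸ hb) hb' ?_)⟩
        rw [h1]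
        exact h2.symm
  obtain ⟨y, a, hn, hy, -, -, hor⟩ := path r
  have hag := agree_mix_of_le hK hL hy
  rw [hn] at hag
  have heq := hag.out_eq hr
  rw [← hX] at heq
  rw [heq] at hor
  tauto

/-- Two templates that look the same near the root, the first of which is matched at the root
along an edge of the template, and the second of which is not. -/
def CriticalPair (A : OutputMap k) (S T : Template k h) : Prop :=
  S.Agree T 1 1 h ∧ S.Matched A 1 ∧ ¬T.Matched A 1

include hr in
theorem criticalPair_shift {K X : Template k h} {y : G k} (hKX : K.Agree X y y h)
    (hy : ¬(K.Matched A y ↔ X.Matched A y)) :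
    ∃ S T : Template k h, CriticalPair A S T := by
  have hs : ∀ T : Template k h, (T.shift y).Matched A 1 ↔ T.Matched A y := by
    intro T
    unfold Matched
    rw [out_shift T hr]
    simp [shift]
  have h1 : (K.shift y).Agree (X.shift y) 1 1 h := by
    intro z hz
    simpa [shift] using hKX z hz
  have h2 : (X.shift y).Agree (K.shift y) 1 1 h :=
    fun z hz => ⟨(h1 z hz).1.symm, (h1 z hz).2.symm⟩
  by_cases hK : K.Matched A y
  · exact ⟨_, _, h1, (hs K).2 hK, fun h => hy ⟨fun _ => (hs X).1 h, fun _ => hK⟩⟩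
  · have hX : X.Matched A y := by
      by_contra hX
      exact hy ⟨fun h => absurd h hK, fun h => absurd h hX⟩
    exact ⟨_, _, h2, (hs X).2 hX, fun h => hK ((hs K).1 h)⟩

include hr hmatch hh in
theorem exists_criticalPair_succ {S T : Template k h} (hST : S.Agree T 1 1 h)
    (hcS : c ∉ S.E 1) (hcS' : c ≠ S.m 1) (hcT : c ∉ T.E 1) (hcT' : c ≠ T.m 1)
    (hT : T.out A 1 = (c : WithBot (Fin k))) (hS : S.out A 1 ≠ (c : WithBot (Fin k))) :
    ∃ S' T' : Template k (h + 1), CriticalPair A S' T' := by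
  have mem : ∀ R : Template k h, c ∉ R.E 1 → c ≠ R.m 1 → c ∈ (R.extend hh c).E 1 := by
    intro R h1 h2
    have h3 := R.pick_eq h1 h2
    simp only [extend, act_one, h3]
    exact Finset.mem_insert_self _ _
  have hK := mem T hcT hcT'
  have hL := mem S hcS hcS'
  have hLK := hST.extend hh c
  have hKL : (T.extend hh c).Agree (S.extend hh c) 1 1 h :=
    fun z hz => ⟨(hLK z hz).1.symm, (hLK z hz).2.symm⟩
  have oK : (T.extend hh c).out A 1 = (c : WithBot (Fin k)) := by
    rw [out_extend, act_one, hT]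
  have oL : (S.extend hh c).out A 1 ≠ (c : WithBot (Fin k)) := by
    rw [out_extend, act_one]
    exact hS
  -- `K` uses the glued edge and `L` does not, so the mix disagrees with `L` or with `K` on it. In
  -- the first case everything is viewed from the other end.
  by_cases hX : (mix _ _ hK hL).out A 1 = (c : WithBot (Fin k))
  · have hX' : (mix _ _ hL hK).out A 1 = (c : WithBot (Fin k)) := by
      have h1 := (mix _ _ hK hL).out_act hr hmatch hX
      have h2 : c ∈ (mix _ _ hK hL).E 1 := by
        rwa [(mix_of_pos hK hL (by simp [len_one, len_gen])).1]
      rw [act_gen_of_mem _ h2, one_mul] at h1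
      rw [← h1]
      exact Agree.out_eq hr fun z _ => by
        rw [one_mul]
        exact ⟨(mix_gen_mul hK hL z).1.symm, (mix_gen_mul hK hL z).2.symm⟩
    obtain ⟨y, hy, hxor⟩ := exists_matched_xor hr hmatch hL hK (.inr ⟨hX', oL⟩)
    exact criticalPair_shift hr (agree_mix hL hK hLK (S.extend_gen_mul hh c hcS) hy) hxor
  · obtain ⟨y, hy, hxor⟩ := exists_matched_xor hr hmatch hK hL (.inl ⟨oK, hX⟩)
    exact criticalPair_shift hr (agree_mix hK hL hKL (T.extend_gen_mul hh c hcT) hy) hxor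

/-! ### Induction on the degree -/

variable {T} in
include hmatch in
theorem out_eq_bot_or_free {x : G k} (hx : ¬T.Matched A x) :
    T.out A x = ⊥ ∨ ∃ c, c ∉ T.E x ∧ c ≠ T.m x ∧ T.out A x = (c : WithBot (Fin k)) := by
  rcases ho : T.out A x with _ | c
  · exact .inl rfl
  · refine .inr ⟨c, fun hc => hx ⟨c, hc, ho⟩, ?_, rfl⟩
    rintro rfl
    exact T.out_ne_m hmatch x ho

/-- The template without edges and with a constant forbidden colour. -/
def const (a : Fin k) : Template k 0 where
  E _ := ∅
  m _ := a
  card_E _ := rfl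
  m_notMem _ := Finset.notMem_empty _
  symm _ _ hc := hc

include hr hmatch in
theorem exists_const_pair (hk : 3 ≤ k) : ∃ a b c : Fin k, c ≠ a ∧ c ≠ b ∧
    (const a).out A 1 = (c : WithBot (Fin k)) ∧ (const b).out A 1 ≠ (c : WithBot (Fin k)) := by
  have hf : ∀ a : Fin k, ∃ c : Fin k, c ≠ a ∧ (const a).out A 1 = (c : WithBot (Fin k)) := by
    intro a
    have h1 : ¬(const a).Matched A 1 := by
      rintro ⟨b, hb, -⟩
      exact Finset.notMem_empty _ hb
    rcases out_eq_bot_or_free hmatch h1 with h2 | ⟨c, -, hc, h2⟩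
    · exact absurd h2 ((const a).out_ne_bot hr hmatch (by omega) 1)
    · exact ⟨c, hc, h2⟩
  choose f hne hout using hf
  have a : Fin k := ⟨0, by omega⟩
  by_cases h : ∃ b, b ≠ f a ∧ f b ≠ f a
  · obtain ⟨b, h1, h2⟩ := h
    refine ⟨a, b, f a, hne a, h1.symm, hout a, ?_⟩
    rw [hout b]
    exact fun h => h2 (WithBot.coe_injective h)
  · push Not at h
    -- Here `f` equals `f a` at every colour other than `f a`, but not at `f a` itself. A third
    -- colour `b` separates the two values.
    obtain ⟨b, hb⟩ : ∃ b, b ∉ ({f a, f (f a)} : Finset (Fin k)) := by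
      have : ({f a, f (f a)} : Finset (Fin k)).card < (Finset.univ : Finset (Fin k)).card := by
        rw [Finset.card_univ, Fintype.card_fin]
        exact Finset.card_le_two.trans_lt hk
      obtain ⟨b, -, hb⟩ := Finset.exists_mem_notMem_of_card_lt_card this
      exact ⟨b, hb⟩
    simp only [Finset.mem_insert, Finset.mem_singleton, not_or] at hb
    refine ⟨f a, b, f (f a), hne _, Ne.symm hb.2, hout _, ?_⟩
    rw [hout b, h b hb.1]
    exact fun h => hne (f a) (WithBot.coe_injective h).symm

include hr hmatch in
theorem exists_criticalPair (hk : 3 ≤ k) (n : ℕ) (hn : n + 1 < k) :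
    ∃ S T : Template k (n + 1), CriticalPair A S T := by
  induction n with
  | zero =>
    obtain ⟨a, b, c, hca, hcb, h1, h2⟩ := exists_const_pair hr hmatch hk
    exact exists_criticalPair_succ hr hmatch hn (fun z hz => absurd hz (Nat.not_lt_zero _))
      (Finset.notMem_empty c) hcb (Finset.notMem_empty c) hca h1 h2
  | succ n ih =>
    obtain ⟨S, T, hag, ⟨b, hb, hS⟩, hT⟩ := ih (by omega)
    rcases out_eq_bot_or_free hmatch hT with h1 | ⟨c, hc, hc', h1⟩
    · exact absurd h1 (T.out_ne_bot hr hmatch hn 1)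
    · obtain ⟨e1, e2⟩ := hag 1 (by simp [len_one])
      rw [mul_one] at e1 e2
      -- The output of `S` is an edge colour of both templates at the root, whereas `c` is free in
      -- both.
      refine exists_criticalPair_succ hr hmatch hn hag (e1 ▸ hc) (e2 ▸ hc') hc hc' h1 ?_
      rw [hS]
      intro h
      rw [WithBot.coe_injective h, e1] at hb
      exact hc hb

end Template

end MaximalMatching

open MaximalMatching
theorem mainTheorem2 (k d : ℕ) (hk : 3 ≤ k) (hd : d = k - 1) (A : OutputMap k)
    (hA : A.IsDistributedAlgorithm)
    (hmatch : ∀ V : ColourSystem k, V.IsRegular d → A.FindsMaximalMatching V) :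
    (∃ U V : ColourSystem k, U.IsRegular d ∧ V.IsRegular d ∧
      trunc U.carrier d = trunc V.carrier d ∧ A U U.root ≠ ⊥ ∧ A V V.root = ⊥) ∧
    (∀ r : ℕ, A.HasRunningTime r → d ≤ r) := by
  subst hd
  obtain ⟨r, hr⟩ := hA
  have key : ∃ U V : ColourSystem k, U.IsRegular (k - 1) ∧ V.IsRegular (k - 1) ∧
      trunc U.carrier (k - 1) = trunc V.carrier (k - 1) ∧
      A U U.root ≠ ⊥ ∧ A V V.root = ⊥ := by
    obtain ⟨S, T, hag, ⟨b, -, hS⟩, hT⟩ :=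
      Template.exists_criticalPair hr hmatch hk (k - 2) (by omega)
    refine ⟨S.real 1, T.real 1, S.real_isRegular 1, T.real_isRegular 1, ?_, ?_, ?_⟩
    · rw [show k - 1 = k - 2 + 1 by omega]
      exact hag.trunc_real
    · intro h
      exact WithBot.coe_ne_bot (hS.symm.trans h)
    · rcases Template.out_eq_bot_or_free hmatch hT with h | ⟨c, hc, hc', -⟩
      · exact h
      -- The `k - 1` edges and the forbidden colour already exhaust the `k` colours, so `c` cannot
      -- be free.
      · have h1 : (insert c (insert (T.m 1) (T.E 1))).card ≤ Fintype.card (Fin k) :=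
          Finset.card_le_univ _
        rw [Finset.card_insert_of_notMem (by simp [hc, hc']),
          Finset.card_insert_of_notMem (T.m_notMem 1), T.card_E, Fintype.card_fin] at h1
        omega
  refine ⟨key, fun s hs => ?_⟩
  obtain ⟨U, V, -, -, htr, hU, hV⟩ := key
  -- If `s < d`, then views of radius `s + 1 ≤ d` cannot separate the two roots.
  by_contra! hlt
  apply hU
  rw [← hV]
  refine hs U V _ _ ?_
  simp only [ColourSystem.root, translate_one]
  ext x
  have hx := Set.ext_iff.1 htr x
  simp only [trunc, Set.mem_ofPred_eq] at hx ⊢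
  constructor
  · rintro ⟨h1, h2⟩
    exact ⟨(hx.1 ⟨h1, by omega⟩).1, h2⟩
  · rintro ⟨h1, h2⟩
    exact ⟨(hx.2 ⟨h1, by omega⟩).1, h2⟩
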